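/- Let $\mathbb{N}$ denote the set of positive integers and $\mathbb{P}$ the set of primes. Let $\mathcal{A}=\{a_k\}_{k=1}^{\infty}$ be a strictly increasing sequence of positive integers, and put $\mathcal{A}(x)=\#\{k\in\mathbb{N}: a_k\le x\}$ and $\mathcal{A}(x,r)=\#\{k\in\mathbb{N}: a_k\le x \text{ and } a_k+r=a_l\text{ for some } l\in\mathbb{N}\}$. Suppose that there are a positive function $\eta$, positive constants $K_1,K_2,K_3,K_4$ and a real number $X$ such that for all real $x\ge X$ and all $r\in\mathbb{N}$ \[ \mathcal{A}(x)\le K_1\frac{x}{\eta(x)},\qquad \frac{x}{\eta(x)}\le K_2\,\mathcal{A}(x),\qquad \mathcal{A}(x)\le K_3\,\mathcal{A}(x/2),\qquad \mathcal{A}(x,r)\le K_4\,\frac{r}{\varphi(r)}\,\frac{x}{\eta(x)^2}, \] where $\varphi$ is Euler's totient function. Let $f$ be a polynomial with integer coefficients of degree $d\ge 1$ with positive leading coefficient such that $f(m)\in\mathbb{N}$ for every $m\in\mathbb{N}$, and put \[ r(n)=\#\{(k,p)\in\mathbb{N}\times\mathbb{P}: a_k+f(p)=n\}. \] Then there exist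 positive constants $c_1$ and $c_2$ depending only on $f,K_1,K_2,K_3,K_4$, and a positive constant $x_0$ depending only on $f,K_1,K_2,K_3,K_4$ and $X$, such that \[ \#\Big\{n\in\mathbb{N}: n\le x,\ r(n)\ge c_1\frac{x^{1/d}}{\eta(x)\log x}\Big\}\ \ge\ c_2\,x\,\frac{x^{1/d}}{x^{1/d}+\eta(x)\log x} \] for every real $x\ge x_0$. -/

import Mathlib

open Polynomial

namespace RomanoffSum

/-- `𝒜(x) = #{k : a_k ≤ x}` for a sequence `a` of integers. Sequences are indexed from `0`;
shifting the index changes none of the counts below. -/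
noncomputable def count (a : ℕ → ℕ) (x : ℝ) : ℕ :=
  Set.ncard {k : ℕ | (a k : ℝ) ≤ x}

/-- `𝒜(x, r) = #{k : a_k ≤ x and a_k + r is a term of the sequence}`. -/
noncomputable def countShift (a : ℕ → ℕ) (x : ℝ) (r : ℕ) : ℕ :=
  Set.ncard {k : ℕ | (a k : ℝ) ≤ x ∧ a k + r ∈ Set.range a}

/-- The hypotheses on the sequence `a` and the function `η`, with explicit implied constants
`K₁, K₂, K₃, K₄`, the estimates being required for all real `x ≥ X`:
`a` is a strictly increasing sequence of positive integers, `η` is positive,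
`𝒜(x) ≍ x / η(x)`, `𝒜(x/2) ≫ 𝒜(x)`, and `𝒜(x, r) ≪ (r / φ(r)) x / η(x)²` uniformly in
the positive integer `r`. -/
structure Admissible (K₁ K₂ K₃ K₄ X : ℝ) (a : ℕ → ℕ) (η : ℝ → ℝ) : Prop where
  pos : ∀ k, 0 < a k
  strictMono : StrictMono a
  eta_pos : ∀ x, X ≤ x → 0 < η x
  count_le : ∀ x, X ≤ x → (count a x : ℝ) ≤ K₁ * (x / η x)
  le_count : ∀ x, X ≤ x → x / η x ≤ K₂ * (count a x : ℝ)
  count_half : ∀ x, X ≤ x → (count a x : ℝ) ≤ K₃ * (count a (x / 2) : ℝ)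
  countShift_le : ∀ x, X ≤ x → ∀ r : ℕ, 0 < r →
    (countShift a x r : ℝ) ≤ K₄ * ((r : ℝ) / (Nat.totient r : ℝ) * (x / η x ^ 2))

/-- `r(n) = #{(k, p) : p prime, a_k + f(p) = n}`. -/
noncomputable def rep (a : ℕ → ℕ) (f : ℤ[X]) (n : ℕ) : ℕ :=
  Set.ncard {kp : ℕ × ℕ | kp.2.Prime ∧ (a kp.1 : ℤ) + f.eval (kp.2 : ℤ) = (n : ℤ)}

end RomanoffSum

/-!
The proof is the second moment method. Let `K` be the set of `k` with `a k ≤ x / 2`, and let `Q` be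
the set of primes `p` with `Y / 8 < p ≤ Y`, where `Y` is a small multiple of `x ^ (1 / d)` chosen so
that `f p ≤ x / 2`. The hypotheses and Chebyshev's bounds give
`|K| |Q| ≫ (x / η x) * (x ^ (1 / d) / log x)`. If the number of coincidences
`a k + f p = a l + f q` is `O(|K| |Q| + (|K| |Q|) ^ 2 / x)`, the Cauchy–Schwarz inequality
(`card_sq_le_mul_card_large_fibers`) shows that sufficiently many `n ≤ x` have at least half the
average number of representations.

The coincidences with `f p = f q` number at most `d |K| |Q|`. For the others, with
`r = |f q - f p|`, the hypothesis on shifts reduces the claim to the boundedness of `r / φ(r)` on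
average over `q ∈ Q`, for each fixed `p` (`exists_sum_div_totient_le`). Two elementary facts
replace the usual sieve bounds here.

* `div_totient_le_sum`: `n / φ(n) ≤ 4 (1 + ∑ 1 / √ℓ)`, the sum being over the primes `ℓ ∣ n`. Hence
  only divisibility of `r` by single primes `ℓ` matters.
* `card_largePrimes_mod_mul_log_le`: a residue class modulo a prime `ℓ ≤ Y` contains
  `O((Y / log Y) * (log ℓ / ℓ))` elements of `Q`. This loses a factor `log ℓ` against the
  Brun–Titchmarsh inequality, but follows from the divisibility of the product of an arithmetic
  progression of length `N` by the part of `N!` prime to `ℓ` (`prod_primes_progression_le`).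

Since `f` takes each value modulo `ℓ` on at most `d` classes, the primes `ℓ ≤ Y` contribute
`O(∑ log ℓ / ℓ ^ (3 / 2)) = O(1)` on average, and `r` has at most `d + 1` prime factors exceeding
`Y`.
-/

namespace RomanoffSum

/-! ### The ratio `n / φ(n)` -/

/-- The product of `p / (p - 1)` over all primes `p ≤ n` is at most `2 √n`: consecutive odd primes
differ by at least `2`, and `√(n - 2) * (n / (n - 1)) ≤ √n`. -/
theorem prod_primes_div_sub_one_le (n : ℕ) (hn : 1 ≤ n) :
    ∏ p ∈ (Finset.range (n + 1)).filter Nat.Prime, ((p : ℝ) / (p - 1)) ≤ 2 * √n := by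
  induction n using Nat.strong_induction_on with
  | _ n ih =>
    rcases Nat.lt_or_ge n 4 with h4 | h4
    · have h2 : (1.4 : ℝ) ≤ √2 := Real.le_sqrt_of_sq_le (by norm_num)
      have h3 : (1.7 : ℝ) ≤ √3 := Real.le_sqrt_of_sq_le (by norm_num)
      interval_cases n
      · have : (Finset.range (1 + 1)).filter Nat.Prime = ∅ := by decide
        rw [this]; norm_num
      · have : (Finset.range (2 + 1)).filter Nat.Prime = {2} := by decide
        rw [this]; norm_num
      · have : (Finset.range (3 + 1)).filter Nat.Prime = {2, 3} := by decide
        rw [this]; norm_num; linarith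
    · obtain ⟨m, rfl⟩ : ∃ m, n = m + 2 := ⟨n - 2, by omega⟩
      by_cases hp : (m + 2).Prime
      · have hp1 : ¬ (m + 1).Prime := by
          intro h
          have h1 := hp.eq_two_or_odd
          have h2 := h.eq_two_or_odd
          omega
        rw [Finset.range_add_one, Finset.filter_insert, if_pos hp,
          Finset.prod_insert (by simp), Finset.range_add_one, Finset.filter_insert, if_neg hp1]
        have h := ih m (by omega) (by omega)
        have hm : (2 : ℝ) ≤ m := by exact_mod_cast (by omega : 2 ≤ m)
        have key : ((m : ℝ) + 2) / (m + 1) * √m ≤ √(m + 2) := by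
          apply Real.le_sqrt_of_sq_le
          rw [mul_pow, Real.sq_sqrt (by linarith), div_pow, div_mul_eq_mul_div,
            div_le_iff₀ (by positivity)]
          nlinarith
        push_cast
        rw [show ((m : ℝ) + 2 - 1) = m + 1 by ring]
        calc ((m : ℝ) + 2) / (m + 1) *
              ∏ p ∈ (Finset.range (m + 1)).filter Nat.Prime, ((p : ℝ) / (p - 1))
            ≤ ((m : ℝ) + 2) / (m + 1) * (2 * √m) := by gcongr
          _ ≤ 2 * √(m + 2) := by linarith
      · rw [Finset.range_add_one, Finset.filter_insert, if_neg hp]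
        refine (ih (m + 1) (by omega) (by omega)).trans ?_
        gcongr
        omega

/-- Adding the primes of `s` one at a time in increasing order, the factor `ℓ / (ℓ - 1)` of a new
largest prime `ℓ` increases the product by at most `2 √ℓ / (ℓ - 1) ≤ 4 / √ℓ`. -/
theorem prod_div_sub_one_le_sum (s : Finset ℕ) (hs : ∀ p ∈ s, p.Prime) :
    ∏ p ∈ s, ((p : ℝ) / (p - 1)) ≤ 4 * (1 + ∑ p ∈ s, 1 / √(p : ℝ)) := by
  induction s using Finset.induction_on_max with
  | empty => simp
  | insert ℓ s hmax ih =>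
    have hns : ℓ ∉ s := fun h => lt_irrefl _ (hmax ℓ h)
    have hℓ := hs ℓ (by simp)
    have hs' : ∀ p ∈ s, p.Prime := fun p hp => hs p (by simp [hp])
    have h2 : (2 : ℝ) ≤ ℓ := by exact_mod_cast hℓ.two_le
    rw [Finset.prod_insert hns, Finset.sum_insert hns]
    have hP : ∏ p ∈ s, ((p : ℝ) / (p - 1)) ≤ 2 * √ℓ := by
      refine le_trans ?_ (prod_primes_div_sub_one_le ℓ hℓ.one_lt.le)
      apply Finset.prod_le_prod_of_subset_of_one_le
      · intro p hp
        simp only [Finset.mem_filter, Finset.mem_range]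
        exact ⟨by have := hmax p hp; omega, hs' p hp⟩
      · intro p hp
        have : (2 : ℝ) ≤ p := by exact_mod_cast (hs' p hp).two_le
        exact div_nonneg (by linarith) (by linarith)
      · intro p hp _
        have : (2 : ℝ) ≤ p := by exact_mod_cast ((Finset.mem_filter.1 hp).2).two_le
        rw [le_div_iff₀ (by linarith)]
        linarith
    have hsq : √(ℓ : ℝ) * √ℓ = ℓ := Real.mul_self_sqrt (by linarith)
    have hpos : 0 < √(ℓ : ℝ) := Real.sqrt_pos.2 (by linarith)
    have h1 : 2 * √(ℓ : ℝ) / (ℓ - 1) ≤ 4 * (1 / √ℓ) := by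
      rw [mul_one_div, div_le_div_iff₀ (by linarith) hpos]
      nlinarith
    have h3 : (ℓ : ℝ) / (ℓ - 1) = 1 + 1 / (ℓ - 1) := by
      have : (ℓ : ℝ) - 1 ≠ 0 := by linarith
      field_simp
      ring
    have h4 : 1 / ((ℓ : ℝ) - 1) * ∏ p ∈ s, ((p : ℝ) / (p - 1)) ≤ 2 * √(ℓ : ℝ) / (ℓ - 1) := by
      rw [one_div_mul_eq_div]
      have : (0 : ℝ) < ℓ - 1 := by linarith
      gcongr
    rw [h3, add_mul, one_mul]
    linarith [ih hs']

theorem div_totient_le_sum (n : ℕ) (hn : 0 < n) :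
    (n : ℝ) / Nat.totient n ≤ 4 * (1 + ∑ p ∈ n.primeFactors, 1 / √(p : ℝ)) := by
  refine le_trans (le_of_eq ?_)
    (prod_div_sub_one_le_sum n.primeFactors fun p hp => Nat.prime_of_mem_primeFactors hp)
  have hφ : (0 : ℝ) < Nat.totient n := by exact_mod_cast Nat.totient_pos.2 hn
  have h := congrArg (Nat.cast : ℕ → ℝ) (Nat.totient_mul_prod_primeFactors n)
  push_cast at h
  have h' : ∏ p ∈ n.primeFactors, (((p - 1 : ℕ) : ℝ)) = ∏ p ∈ n.primeFactors, ((p : ℝ) - 1) :=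
    Finset.prod_congr rfl fun p hp => by
      rw [Nat.cast_sub (Nat.prime_of_mem_primeFactors hp).one_lt.le, Nat.cast_one]
  rw [h'] at h
  have hne : ∏ p ∈ n.primeFactors, ((p : ℝ) - 1) ≠ 0 := by
    refine Finset.prod_ne_zero_iff.2 fun p hp => ?_
    have : (2 : ℝ) ≤ p := by exact_mod_cast (Nat.prime_of_mem_primeFactors hp).two_le
    linarith
  rw [Finset.prod_div_distrib, div_eq_div_iff hφ.ne' hne, ← h, mul_comm]

/-! ### Primes in arithmetic progressions -/

/-- The product of distinct primes `p > N` among the first `N` terms of an arithmetic progression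
of prime difference `ℓ` is at most `ℓ ^ (2 * N)`. Modulo the part `M` of `N!` prime to `ℓ` the
progression is a unit multiple of `N` consecutive integers, so `M` and the primes in question,
which are coprime to `M`, all divide the product of the progression; this product is at most
`ℓ ^ N * N!`, and `N!` is at most `ℓ ^ N * M`. -/
theorem prod_primes_progression_le {ℓ v N : ℕ} (hℓ : ℓ.Prime) (hv : 0 < v) (hvℓ : v ≤ ℓ)
    (s : Finset ℕ) (hs : ∀ p ∈ s, p.Prime ∧ N < p ∧ ∃ k < N, p = v + k * ℓ) :
    ∏ p ∈ s, p ≤ ℓ ^ (2 * N) := by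
  set M := ordCompl[ℓ] N.factorial with hM
  have hMdvd : M ∣ N.factorial := Nat.ordCompl_dvd _ _
  have hMpos : 0 < M := Nat.pos_of_dvd_of_pos hMdvd N.factorial_pos
  have hcop : Nat.Coprime ℓ M := Nat.coprime_ordCompl hℓ N.factorial_ne_zero
  set P := ∏ k ∈ Finset.range N, (v + k * ℓ) with hP
  have hMP : M ∣ P := by
    rw [← CharP.cast_eq_zero_iff (ZMod M) M P]
    obtain ⟨w, hw⟩ := ZMod.intCast_surjective ((v : ZMod M) * (ℓ : ZMod M)⁻¹)
    have hinv : (ℓ : ZMod M) * (ℓ : ZMod M)⁻¹ = 1 := ZMod.coe_mul_inv_eq_one ℓ hcop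
    have hz : ((∏ k ∈ Finset.range N, (w + (k : ℤ)) : ℤ) : ZMod M) = 0 := by
      rw [ZMod.intCast_zmod_eq_zero_iff_dvd] 
      exact (Int.natCast_dvd_natCast.2 hMdvd).trans (Nat.factorial_coe_dvd_prod N w)
    have hPz : (P : ZMod M) = (ℓ : ZMod M) ^ N *
        ((∏ k ∈ Finset.range N, (w + (k : ℤ)) : ℤ) : ZMod M) := by
      rw [hP]
      push_cast
      rw [hw]
      conv_rhs => rw [← Finset.card_range N, ← Finset.prod_const, Finset.card_range,
        ← Finset.prod_mul_distrib]
      refine Finset.prod_congr rfl fun k _ => ?_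
      linear_combination (-(v : ZMod M)) * hinv
    rw [hPz, hz, mul_zero]
  have hsP : ∏ p ∈ s, p ∣ P := by
    refine Finset.prod_primes_dvd _ (fun p hp => (hs p hp).1.prime) fun p hp => ?_
    obtain ⟨-, -, k, hk, rfl⟩ := hs p hp
    exact Finset.dvd_prod_of_mem (fun k => v + k * ℓ) (Finset.mem_range.2 hk)
  have hcopM : Nat.Coprime (∏ p ∈ s, p) M := by
    refine Nat.Coprime.prod_left fun p hp => ?_
    refine Nat.Coprime.coprime_dvd_right hMdvd ?_
    rw [(hs p hp).1.coprime_iff_not_dvd, (hs p hp).1.dvd_factorial]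
    exact not_le.2 (hs p hp).2.1
  have hPpos : 0 < P := Finset.prod_pos fun k _ => by omega
  have h1 : (∏ p ∈ s, p) * M ≤ P :=
    Nat.le_of_dvd hPpos (hcopM.mul_dvd_of_dvd_of_dvd hsP hMP)
  have h2 : P ≤ ℓ ^ N * N.factorial := by
    calc P ≤ ∏ k ∈ Finset.range N, (ℓ * (k + 1)) :=
          Finset.prod_le_prod' fun k _ => by nlinarith
      _ = ℓ ^ N * N.factorial := by
          rw [Finset.prod_mul_distrib, Finset.prod_const, Finset.card_range,
            Finset.prod_range_add_one_eq_factorial]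
  have h3 : N.factorial ≤ ℓ ^ N * M := by
    calc N.factorial = ordProj[ℓ] N.factorial * M := (Nat.ordProj_mul_ordCompl_eq_self _ _).symm
      _ ≤ ℓ ^ N * M := by
          gcongr
          · exact hℓ.one_lt.le
          · exact (Nat.factorization_factorial_le_div_pred hℓ N).trans (Nat.div_le_self _ _)
  refine Nat.le_of_mul_le_mul_right (h1.trans (h2.trans ?_)) hMpos
  calc ℓ ^ N * N.factorial ≤ ℓ ^ N * (ℓ ^ N * M) := by gcongr
    _ = ℓ ^ (2 * N) * M := by ring

/-- The primes `p` with `Y / 8 < p ≤ Y`. Discarding the small primes costs only a constant factor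
and makes all of them exceed the length `Y / ℓ + 1` of a progression of prime
difference `ℓ ≥ 16`, once `Y ≥ 16`. -/
def largePrimes (Y : ℕ) : Finset ℕ :=
  (Finset.range (Y + 1)).filter fun p => p.Prime ∧ Y < 8 * p

theorem mem_largePrimes {Y p : ℕ} : p ∈ largePrimes Y ↔ p ≤ Y ∧ p.Prime ∧ Y < 8 * p := by
  simp [largePrimes]

theorem eventually_le_card_largePrimes_mul_log :
    ∃ Y₀ : ℕ, ∀ Y : ℕ, Y₀ ≤ Y →
      Real.log 2 / 4 * Y ≤ (largePrimes Y).card * Real.log Y := by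
  have hlo := (isLittleO_log_rpow_atTop (show (0 : ℝ) < 1 / 2 by norm_num)).bound
    (show (0 : ℝ) < 1 / 16 by norm_num)
  obtain ⟨Y₀, hY₀⟩ := Filter.eventually_atTop.1 (tendsto_natCast_atTop_atTop.eventually hlo)
  refine ⟨max Y₀ 2, fun Y hY => ?_⟩
  have hY2 : 2 ≤ Y := (le_max_right _ _).trans hY
  have hY2' : (2 : ℝ) ≤ Y := by exact_mod_cast hY2
  have hlog := hY₀ Y ((le_max_left _ _).trans hY)
  rw [← Real.sqrt_eq_rpow, Real.norm_of_nonneg (Real.log_nonneg (by linarith)),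
    Real.norm_of_nonneg (Real.sqrt_nonneg _)] at hlog
  have hsq : √(Y : ℝ) * √Y = Y := Real.mul_self_sqrt (by linarith)
  have hs1 : 1 ≤ √(Y : ℝ) := Real.one_le_sqrt.2 (by linarith)
  have hlog1 : Real.log (Y + 1) ≤ 2 * Real.log Y := by
    rw [← Nat.cast_ofNat (R := ℝ), ← Real.log_pow]
    exact Real.log_le_log (by linarith) (by nlinarith)
  have hge := Chebyshev.theta_ge Y
  have hle := Chebyshev.theta_le_log4_mul_x (x := (Y : ℝ) / 8) (by positivity)
  have h4 : Real.log 4 = 2 * Real.log 2 := by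
    rw [show (4 : ℝ) = 2 ^ 2 by norm_num, Real.log_pow]; norm_num
  have hl2 := Real.log_two_gt_d9
  have hsplit : Chebyshev.theta Y ≤
      (∑ p ∈ largePrimes Y, Real.log p) + Chebyshev.theta ((Y : ℝ) / 8) := by
    have hsub : (Finset.Ioc 0 ⌊(Y : ℝ)⌋₊).filter Nat.Prime ⊆
        largePrimes Y ∪ (Finset.Ioc 0 ⌊(Y : ℝ) / 8⌋₊).filter Nat.Prime := by
      intro p hp
      simp only [Finset.mem_filter, Finset.mem_Ioc, Nat.floor_natCast, Finset.mem_union,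
        mem_largePrimes] at hp ⊢
      rcases Nat.lt_or_ge Y (8 * p) with h | h
      · exact Or.inl ⟨hp.1.2, hp.2, h⟩
      · refine Or.inr ⟨⟨hp.1.1, Nat.le_floor ?_⟩, hp.2⟩
        have : (8 : ℝ) * p ≤ Y := by exact_mod_cast h
        linarith
    unfold Chebyshev.theta
    refine (Finset.sum_le_sum_of_subset_of_nonneg hsub fun p _ _ => Real.log_natCast_nonneg p).trans
      ?_
    rw [← Finset.sum_union_inter]
    exact le_add_of_nonneg_right (Finset.sum_nonneg fun p _ => Real.log_natCast_nonneg p)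
  have hcard : ∑ p ∈ largePrimes Y, Real.log p ≤ (largePrimes Y).card * Real.log Y := by
    rw [← nsmul_eq_mul]
    refine Finset.sum_le_card_nsmul _ _ _ fun p hp => ?_
    have hp := mem_largePrimes.1 hp
    exact Real.log_le_log (by exact_mod_cast hp.2.1.pos) (by exact_mod_cast hp.1)
  rw [h4] at hle
  nlinarith

/-- A Brun–Titchmarsh type bound, weaker by the factor `log ℓ`. -/
theorem card_largePrimes_mod_mul_log_le {Y ℓ v : ℕ} (hY : 64 ≤ Y) (hℓ : ℓ.Prime) (hℓ16 : 16 ≤ ℓ)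
    (hℓY : ℓ ≤ Y) (hv : v < ℓ) :
    (((largePrimes Y).filter fun q => q % ℓ = v).card : ℝ) * Real.log Y ≤
      8 * (Y / ℓ) * Real.log ℓ := by
  set s := (largePrimes Y).filter fun q => q % ℓ = v with hs
  set N := Y / ℓ + 1 with hN
  have hN1 : 1 ≤ N := Nat.le_add_left 1 _
  have hprod : ∏ p ∈ s, p ≤ ℓ ^ (2 * N) := by
    -- in the class `0` the progression would start with `0`, but `ℓ` is its only prime
    rcases Nat.eq_zero_or_pos v with rfl | hvpos
    · have hsub : s ⊆ {ℓ} := by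
        intro q hq
        obtain ⟨hq, hqv⟩ := Finset.mem_filter.1 hq
        rw [Finset.mem_singleton]
        exact ((Nat.prime_dvd_prime_iff_eq hℓ (mem_largePrimes.1 hq).2.1).1
          (Nat.dvd_of_mod_eq_zero hqv)).symm
      calc ∏ p ∈ s, p ≤ ∏ p ∈ {ℓ}, p := Finset.prod_le_prod_of_subset_of_one_le' hsub
            fun p hp _ => (Finset.mem_singleton.1 hp) ▸ hℓ.one_lt.le
        _ = ℓ ^ 1 := by simp
        _ ≤ ℓ ^ (2 * N) := Nat.pow_le_pow_right hℓ.pos (by linarith)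
    · refine prod_primes_progression_le hℓ hvpos hv.le s fun p hp => ?_
      obtain ⟨hp, hpv⟩ := Finset.mem_filter.1 hp
      obtain ⟨hpY, hpp, hp8⟩ := mem_largePrimes.1 hp
      refine ⟨hpp, ?_, p / ℓ, ?_, ?_⟩
      · have : Y / ℓ ≤ Y / 16 := Nat.div_le_div_left hℓ16 (by norm_num)
        omega
      · exact Nat.lt_succ_of_le (Nat.div_le_div_right hpY)
      · rw [← hpv, mul_comm, Nat.mod_add_div]
  have hY' : (64 : ℝ) ≤ Y := by exact_mod_cast hY
  have hpow : ((Y : ℝ) / 8) ^ s.card ≤ (ℓ : ℝ) ^ (2 * N) := by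
    calc ((Y : ℝ) / 8) ^ s.card = ∏ _p ∈ s, ((Y : ℝ) / 8) := by rw [Finset.prod_const]
      _ ≤ ∏ p ∈ s, (p : ℝ) := by
          refine Finset.prod_le_prod (fun _ _ => by positivity) fun p hp => ?_
          have h := (mem_largePrimes.1 (Finset.mem_filter.1 hp).1).2.2
          have : (Y : ℝ) ≤ 8 * p := by exact_mod_cast h.le
          linarith
      _ = ((∏ p ∈ s, p : ℕ) : ℝ) := by rw [Nat.cast_prod]
      _ ≤ (ℓ : ℝ) ^ (2 * N) := by rw [← Nat.cast_pow]; exact Nat.cast_le.2 hprod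
  have hlog := Real.log_le_log (by positivity) hpow
  rw [Real.log_pow, Real.log_pow] at hlog
  have hlogY : Real.log Y ≤ 2 * Real.log ((Y : ℝ) / 8) := by
    rw [← Nat.cast_ofNat (R := ℝ) (n := 2), ← Real.log_pow]
    exact Real.log_le_log (by linarith) (by nlinarith)
  have hℓ0 : (0 : ℝ) < ℓ := by exact_mod_cast hℓ.pos
  have hNle : (N : ℝ) ≤ 2 * (Y / ℓ) := by
    have h1 : ((Y / ℓ : ℕ) : ℝ) ≤ (Y : ℝ) / ℓ := Nat.cast_div_le
    have h2 : (1 : ℝ) ≤ (Y : ℝ) / ℓ := by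
      rw [one_le_div hℓ0]; exact_mod_cast hℓY
    rw [hN]; push_cast; linarith
  have hlogℓ : 0 ≤ Real.log ℓ := Real.log_natCast_nonneg ℓ
  calc (s.card : ℝ) * Real.log Y ≤ s.card * (2 * Real.log ((Y : ℝ) / 8)) := by gcongr
    _ = 2 * (s.card * Real.log ((Y : ℝ) / 8)) := by ring
    _ ≤ 2 * (((2 * N : ℕ) : ℝ) * Real.log ℓ) := by gcongr
    _ = 4 * N * Real.log ℓ := by push_cast; ring
    _ ≤ 4 * (2 * (Y / ℓ)) * Real.log ℓ := by gcongr
    _ = 8 * (Y / ℓ) * Real.log ℓ := by ring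

/-! ### Prime divisors of differences of polynomial values -/

/-- A polynomial of degree `d ≥ 1` whose leading coefficient is not divisible by the prime `ℓ`
takes each value modulo `ℓ` on at most `d` residue classes. -/
theorem exists_residues_of_dvd_eval_sub (f : ℤ[X]) (hd : 1 ≤ f.natDegree) {ℓ : ℕ} (hℓ : ℓ.Prime)
    (hlc : ¬ (ℓ : ℤ) ∣ f.leadingCoeff) (c : ℤ) :
    ∃ V : Finset ℕ, V.card ≤ f.natDegree ∧ (∀ v ∈ V, v < ℓ) ∧
      ∀ q : ℕ, (ℓ : ℤ) ∣ f.eval (q : ℤ) - c → q % ℓ ∈ V := by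
  have : Fact ℓ.Prime := ⟨hℓ⟩
  set g : (ZMod ℓ)[X] := (f - C c).map (Int.castRingHom (ZMod ℓ)) with hg
  have hlc' : Int.castRingHom (ZMod ℓ) (f - C c).leadingCoeff ≠ 0 := by
    rw [leadingCoeff_sub_of_degree_lt]
    · rw [eq_intCast, Ne, ZMod.intCast_zmod_eq_zero_iff_dvd]
      exact hlc
    · exact degree_C_le.trans_lt (natDegree_pos_iff_degree_pos.1 hd)
  have hg0 : g ≠ 0 := by
    intro h
    apply hlc'
    have := congrArg (fun r => coeff r (f - C c).natDegree) h
    rwa [hg, coeff_map, coeff_zero] at this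
  have hgd : g.natDegree ≤ f.natDegree := natDegree_map_le.trans (natDegree_sub_C (a := c)).le
  refine ⟨g.roots.toFinset.image ZMod.val, ?_, ?_, ?_⟩
  · exact Finset.card_image_le.trans ((Multiset.toFinset_card_le _).trans
      ((card_roots' g).trans hgd))
  · intro v hv
    obtain ⟨z, -, rfl⟩ := Finset.mem_image.1 hv
    exact ZMod.val_lt z
  · intro q hq
    refine Finset.mem_image.2 ⟨(q : ZMod ℓ), ?_, ZMod.val_natCast ℓ q⟩
    rw [Multiset.mem_toFinset, mem_roots hg0, IsRoot.def, hg, eval_map,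
      show (q : ZMod ℓ) = Int.castRingHom (ZMod ℓ) (q : ℤ) by simp, eval₂_at_apply, eq_intCast,
      ZMod.intCast_zmod_eq_zero_iff_dvd]
    simpa using hq

theorem card_largePrimes_dvd_eval_sub_mul_log_le (f : ℤ[X]) (hd : 1 ≤ f.natDegree) {Y ℓ : ℕ}
    (hY : 64 ≤ Y) (hℓ : ℓ.Prime) (hℓ16 : 16 ≤ ℓ) (hℓY : ℓ ≤ Y)
    (hlc : ¬ (ℓ : ℤ) ∣ f.leadingCoeff) (c : ℤ) :
    (((largePrimes Y).filter fun q : ℕ => (ℓ : ℤ) ∣ f.eval (q : ℤ) - c).card : ℝ) * Real.log Y ≤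
      f.natDegree * (8 * (Y / ℓ) * Real.log ℓ) := by
  obtain ⟨V, hVcard, hVlt, hV⟩ := exists_residues_of_dvd_eval_sub f hd hℓ hlc c
  have hsub : ((largePrimes Y).filter fun q : ℕ => (ℓ : ℤ) ∣ f.eval (q : ℤ) - c) ⊆
      V.biUnion fun v => (largePrimes Y).filter fun q => q % ℓ = v := by
    intro q hq
    obtain ⟨hq, hqd⟩ := Finset.mem_filter.1 hq
    exact Finset.mem_biUnion.2 ⟨q % ℓ, hV q hqd, Finset.mem_filter.2 ⟨hq, rfl⟩⟩
  have hlogY : 0 ≤ Real.log Y := Real.log_natCast_nonneg Y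
  have hlogℓ : 0 ≤ Real.log ℓ := Real.log_natCast_nonneg ℓ
  calc _ ≤ ((∑ v ∈ V, ((largePrimes Y).filter fun q => q % ℓ = v).card : ℕ) : ℝ) * Real.log Y := by
        gcongr
        exact (Finset.card_le_card hsub).trans Finset.card_biUnion_le
    _ = ∑ v ∈ V, (((largePrimes Y).filter fun q => q % ℓ = v).card : ℝ) * Real.log Y := by
        push_cast; rw [Finset.sum_mul]
    _ ≤ V.card • (8 * ((Y : ℝ) / ℓ) * Real.log ℓ) :=
        Finset.sum_le_card_nsmul _ _ _ fun v hv =>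
          card_largePrimes_mod_mul_log_le hY hℓ hℓ16 hℓY (hVlt v hv)
    _ ≤ f.natDegree * (8 * (Y / ℓ) * Real.log ℓ) := by
        rw [nsmul_eq_mul]
        gcongr

theorem exists_abs_eval_le (f : ℤ[X]) :
    ∃ F : ℕ, 0 < F ∧ ∀ m Y : ℕ, 1 ≤ Y → m ≤ Y →
      (f.eval (m : ℤ)).natAbs ≤ F * Y ^ f.natDegree := by
  refine ⟨∑ i ∈ Finset.range (f.natDegree + 1), (f.coeff i).natAbs + 1, by omega,
    fun m Y hY hm => ?_⟩
  rw [eval_eq_sum_range]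
  calc _ ≤ ∑ i ∈ Finset.range (f.natDegree + 1), (f.coeff i * (m : ℤ) ^ i).natAbs :=
        Int.natAbs_sum_le _ _
    _ ≤ ∑ i ∈ Finset.range (f.natDegree + 1), (f.coeff i).natAbs * Y ^ f.natDegree := by
        refine Finset.sum_le_sum fun i hi => ?_
        rw [Int.natAbs_mul, Int.natAbs_pow, Int.natAbs_natCast]
        refine Nat.mul_le_mul_left _ ?_
        calc m ^ i ≤ Y ^ i := by gcongr
          _ ≤ Y ^ f.natDegree :=
            Nat.pow_le_pow_right hY (Nat.lt_succ_iff.1 (Finset.mem_range.1 hi))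
    _ ≤ _ := by
        rw [← Finset.sum_mul]
        gcongr
        omega

/-- Of the prime factors of `r ≤ Y ^ k`, those below `M` contribute at most `M`, and those above `Y`
at most `k`, because there are at most `k` of them. -/
theorem sum_sqrt_primeFactors_le {r M Y k : ℕ} (hr : 0 < r) (hY : 2 ≤ Y) (hrY : r ≤ Y ^ k) :
    ∑ ℓ ∈ r.primeFactors, 1 / √(ℓ : ℝ) ≤ M + k +
      ∑ ℓ ∈ (Finset.range (Y + 1)).filter fun ℓ => ℓ.Prime ∧ M ≤ ℓ,
        if ℓ ∣ r then 1 / √(ℓ : ℝ) else 0 := by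
  have hle1 : ∀ ℓ ∈ r.primeFactors, 1 / √(ℓ : ℝ) ≤ 1 := fun ℓ hℓ => by
    have h1 : (1 : ℝ) ≤ ℓ := by exact_mod_cast (Nat.prime_of_mem_primeFactors hℓ).one_lt.le
    rw [div_le_one (Real.sqrt_pos.2 (by linarith))]
    exact Real.one_le_sqrt.2 h1
  have hA : ∑ ℓ ∈ r.primeFactors.filter (· < M), 1 / √(ℓ : ℝ) ≤ M := by
    calc _ ≤ (r.primeFactors.filter (· < M)).card • (1 : ℝ) :=
          Finset.sum_le_card_nsmul _ _ _ fun ℓ hℓ => hle1 ℓ (Finset.mem_filter.1 hℓ).1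
      _ ≤ M := by
          rw [nsmul_eq_mul, mul_one]
          have : r.primeFactors.filter (· < M) ⊆ Finset.range M := fun ℓ hℓ =>
            Finset.mem_range.2 (Finset.mem_filter.1 hℓ).2
          have := Finset.card_le_card this
          rw [Finset.card_range] at this
          exact_mod_cast this
  have hC : ∑ ℓ ∈ r.primeFactors.filter (Y < ·), 1 / √(ℓ : ℝ) ≤ k := by
    set s := r.primeFactors.filter (Y < ·) with hs
    have hsc : s.card ≤ k := by
      rw [← Nat.pow_le_pow_iff_right hY]
      calc Y ^ s.card = ∏ _ℓ ∈ s, Y := by rw [Finset.prod_const]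
        _ ≤ ∏ ℓ ∈ s, ℓ := Finset.prod_le_prod' fun ℓ hℓ => (Finset.mem_filter.1 hℓ).2.le
        _ ≤ r := by
            refine Nat.le_of_dvd hr (Finset.prod_primes_dvd r ?_ ?_)
            · exact fun ℓ hℓ => (Nat.prime_of_mem_primeFactors (Finset.mem_filter.1 hℓ).1).prime
            · exact fun ℓ hℓ => Nat.dvd_of_mem_primeFactors (Finset.mem_filter.1 hℓ).1
        _ ≤ Y ^ k := hrY
    calc _ ≤ s.card • (1 : ℝ) :=
          Finset.sum_le_card_nsmul _ _ _ fun ℓ hℓ => hle1 ℓ (Finset.mem_filter.1 hℓ).1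
      _ ≤ k := by
          rw [nsmul_eq_mul, mul_one]
          exact_mod_cast hsc
  have hB : ∑ ℓ ∈ r.primeFactors.filter (fun ℓ => M ≤ ℓ ∧ ℓ ≤ Y), 1 / √(ℓ : ℝ) ≤
      ∑ ℓ ∈ (Finset.range (Y + 1)).filter fun ℓ => ℓ.Prime ∧ M ≤ ℓ,
        if ℓ ∣ r then 1 / √(ℓ : ℝ) else 0 := by
    rw [← Finset.sum_filter]
    refine Finset.sum_le_sum_of_subset_of_nonneg ?_ fun _ _ _ => by positivity
    intro ℓ hℓ
    simp only [Finset.mem_filter, Nat.mem_primeFactors, Finset.mem_range] at hℓ ⊢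
    exact ⟨⟨by omega, hℓ.1.1, hℓ.2.1⟩, hℓ.1.2.1⟩
  have hsub : r.primeFactors ⊆ (r.primeFactors.filter (· < M) ∪ r.primeFactors.filter (Y < ·)) ∪
      r.primeFactors.filter (fun ℓ => M ≤ ℓ ∧ ℓ ≤ Y) := by
    intro ℓ hℓ
    simp only [Finset.mem_union, Finset.mem_filter, hℓ, true_and]
    omega
  have hunion : ∀ s t : Finset ℕ, ∑ ℓ ∈ s ∪ t, 1 / √(ℓ : ℝ) ≤
      ∑ ℓ ∈ s, 1 / √(ℓ : ℝ) + ∑ ℓ ∈ t, 1 / √(ℓ : ℝ) := fun s t => by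
    rw [← Finset.sum_union_inter]
    exact le_add_of_nonneg_right (Finset.sum_nonneg fun _ _ => by positivity)
  calc _ ≤ _ := Finset.sum_le_sum_of_subset_of_nonneg hsub fun _ _ _ => by positivity
    _ ≤ _ := hunion _ _
    _ ≤ _ := add_le_add (hunion _ _) hB
    _ ≤ _ := by linarith

/-- On average over the large primes `q`, the ratio `r / φ(r)` for `r = |f(q) - f(p)| ≠ 0` is
bounded. -/
theorem exists_sum_div_totient_le (f : ℤ[X]) (hd : 1 ≤ f.natDegree) :
    ∃ C : ℝ, 0 < C ∧ ∃ Y₀ : ℕ, ∀ Y : ℕ, Y₀ ≤ Y → ∀ p : ℕ, p ≤ Y →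
      ∑ q ∈ (largePrimes Y).filter (fun q : ℕ => f.eval (q : ℤ) ≠ f.eval (p : ℤ)),
        (((f.eval (q : ℤ) - f.eval (p : ℤ)).natAbs : ℝ) /
          Nat.totient (f.eval (q : ℤ) - f.eval (p : ℤ)).natAbs) ≤ C * (largePrimes Y).card := by
  obtain ⟨F, hF, hFle⟩ := exists_abs_eval_le f
  obtain ⟨Y₁, hY₁⟩ := eventually_le_card_largePrimes_mul_log
  set d := f.natDegree with hdd
  -- primes `ℓ ≥ M` do not divide the leading coefficient and are at least `16`
  set M := 16 + f.leadingCoeff.natAbs with hM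
  have hZs : Summable fun n : ℕ => 1 / (n : ℝ) ^ (5 / 4 : ℝ) :=
    Real.summable_one_div_nat_rpow.2 (by norm_num)
  set Z := ∑' n : ℕ, 1 / (n : ℝ) ^ (5 / 4 : ℝ) with hZ
  have hZ0 : 0 ≤ Z := tsum_nonneg fun n => by positivity
  have hl2 : 0 < Real.log 2 := Real.log_pos (by norm_num)
  refine ⟨4 * (1 + M + (d + 1 : ℕ)) + 4 * (32 * d * Z * (4 / Real.log 2)), by positivity,
    max Y₁ (64 + 2 * F), fun Y hY p hp => ?_⟩
  have hY1 : Y₁ ≤ Y := (le_max_left _ _).trans hY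
  have hY2 : 64 + 2 * F ≤ Y := (le_max_right _ _).trans hY
  have hlogY : 0 < Real.log Y := Real.log_pos (by exact_mod_cast (by omega : 1 < Y))
  set Q := largePrimes Y with hQ
  set Q' := Q.filter (fun q : ℕ => f.eval (q : ℤ) ≠ f.eval (p : ℤ)) with hQ'
  set W := (Finset.range (Y + 1)).filter fun ℓ => ℓ.Prime ∧ M ≤ ℓ with hW
  set r : ℕ → ℕ := fun q => (f.eval (q : ℤ) - f.eval (p : ℤ)).natAbs with hr
  have hYQ : (Y : ℝ) / Real.log Y ≤ 4 / Real.log 2 * Q.card := by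
    rw [div_le_iff₀ hlogY, mul_assoc, div_mul_eq_mul_div, le_div_iff₀ hl2]
    linarith [hY₁ Y hY1]
  have hpt : ∀ q ∈ Q', (r q : ℝ) / Nat.totient (r q) ≤
      4 * (1 + M + (d + 1 : ℕ)) + 4 * ∑ ℓ ∈ W, if ℓ ∣ r q then 1 / √(ℓ : ℝ) else 0 := by
    intro q hq
    obtain ⟨hq, hne⟩ := Finset.mem_filter.1 hq
    have hr0 : 0 < r q := Int.natAbs_pos.2 (sub_ne_zero.2 hne)
    have hrY : r q ≤ Y ^ (d + 1) := by
      calc r q ≤ (f.eval (q : ℤ)).natAbs + (f.eval (p : ℤ)).natAbs := Int.natAbs_sub_le _ _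
        _ ≤ F * Y ^ d + F * Y ^ d :=
          add_le_add (hFle q Y (by omega) (mem_largePrimes.1 hq).1) (hFle p Y (by omega) hp)
        _ = (2 * F) * Y ^ d := by ring
        _ ≤ Y * Y ^ d := by gcongr; omega
        _ = Y ^ (d + 1) := by ring
    have h1 := div_totient_le_sum (r q) hr0
    have h2 := sum_sqrt_primeFactors_le (M := M) hr0 (by omega) hrY
    linarith
  have hW' : ∀ ℓ ∈ W, ∑ q ∈ Q', (if ℓ ∣ r q then 1 / √(ℓ : ℝ) else 0) ≤
      32 * d * (Y / Real.log Y) * (1 / (ℓ : ℝ) ^ (5 / 4 : ℝ)) := by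
    intro ℓ hℓ
    obtain ⟨hℓY, hℓp, hℓM⟩ := Finset.mem_filter.1 hℓ
    rw [Finset.mem_range, Nat.lt_succ_iff] at hℓY
    have hℓ0 : (0 : ℝ) < ℓ := by exact_mod_cast hℓp.pos
    have hlc : ¬ (ℓ : ℤ) ∣ f.leadingCoeff := by
      intro h
      have hne : f.leadingCoeff ≠ 0 := by
        intro h0
        rw [leadingCoeff_eq_zero] at h0
        rw [hdd, h0, natDegree_zero] at hd
        omega
      have := Nat.le_of_dvd (Int.natAbs_pos.2 hne) (Int.natCast_dvd.1 h)
      omega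
    have hcard := card_largePrimes_dvd_eval_sub_mul_log_le f hd (by omega : 64 ≤ Y) hℓp
      (by omega) hℓY hlc (f.eval (p : ℤ))
    -- this turns the weight `log ℓ / ℓ ^ (3 / 2)` into the summable `ℓ ^ (-5 / 4)`
    have hlogℓ : Real.log ℓ ≤ 4 * (ℓ : ℝ) ^ (1 / 4 : ℝ) := by
      have := Real.log_le_rpow_div hℓ0.le (show (0 : ℝ) < 1 / 4 by norm_num)
      linarith
    have hpow : (ℓ : ℝ) ^ (1 / 4 : ℝ) * (1 / ℓ) * (1 / √(ℓ : ℝ)) = 1 / (ℓ : ℝ) ^ (5 / 4 : ℝ) := by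
      have h : (ℓ : ℝ) ^ (5 / 4 : ℝ) * (ℓ : ℝ) ^ (1 / 4 : ℝ) = ℓ * √(ℓ : ℝ) := by
        rw [Real.sqrt_eq_rpow, ← Real.rpow_add hℓ0, ← Real.rpow_one_add' hℓ0.le (by norm_num)]
        norm_num
      have h1 : 0 < (ℓ : ℝ) ^ (5 / 4 : ℝ) := by positivity
      have h2 : 0 < √(ℓ : ℝ) := Real.sqrt_pos.2 hℓ0
      field_simp
      linarith
    have hle : (∑ q ∈ Q', (if ℓ ∣ r q then 1 / √(ℓ : ℝ) else 0)) ≤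
        ((Q.filter fun q : ℕ => (ℓ : ℤ) ∣ f.eval (q : ℤ) - f.eval (p : ℤ)).card : ℝ) *
          (1 / √(ℓ : ℝ)) := by
      rw [← Finset.sum_filter, Finset.sum_const, nsmul_eq_mul]
      gcongr
      intro q hq
      obtain ⟨hq, hqd⟩ := Finset.mem_filter.1 hq
      exact Finset.mem_filter.2 ⟨(Finset.mem_filter.1 hq).1, Int.natCast_dvd.2 hqd⟩
    refine hle.trans ?_
    rw [← le_div_iff₀ hlogY] at hcard
    calc _ ≤ (d * (8 * ((Y : ℝ) / ℓ) * Real.log ℓ)) / Real.log Y * (1 / √(ℓ : ℝ)) := by gcongr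
      _ ≤ (d * (8 * ((Y : ℝ) / ℓ) * (4 * (ℓ : ℝ) ^ (1 / 4 : ℝ)))) / Real.log Y *
          (1 / √(ℓ : ℝ)) := by gcongr
      _ = 32 * d * (Y / Real.log Y) * ((ℓ : ℝ) ^ (1 / 4 : ℝ) * (1 / ℓ) * (1 / √(ℓ : ℝ))) := by
          ring
      _ = _ := by rw [hpow]
  calc ∑ q ∈ Q', (r q : ℝ) / Nat.totient (r q)
      ≤ ∑ q ∈ Q', (4 * (1 + (M : ℝ) + (d + 1 : ℕ)) +
          4 * ∑ ℓ ∈ W, if ℓ ∣ r q then 1 / √(ℓ : ℝ) else 0) := Finset.sum_le_sum hpt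
    _ = Q'.card * (4 * (1 + (M : ℝ) + (d + 1 : ℕ))) +
          4 * ∑ ℓ ∈ W, ∑ q ∈ Q', (if ℓ ∣ r q then 1 / √(ℓ : ℝ) else 0) := by
        rw [Finset.sum_add_distrib, Finset.sum_const, nsmul_eq_mul, ← Finset.mul_sum,
          Finset.sum_comm]
    _ ≤ Q.card * (4 * (1 + (M : ℝ) + (d + 1 : ℕ))) +
          4 * ∑ ℓ ∈ W, 32 * d * (Y / Real.log Y) * (1 / (ℓ : ℝ) ^ (5 / 4 : ℝ)) := by
        gcongr with ℓ hℓ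
        · exact Finset.filter_subset _ _
        · exact hW' ℓ hℓ
    _ ≤ Q.card * (4 * (1 + (M : ℝ) + (d + 1 : ℕ))) +
          4 * (32 * d * (4 / Real.log 2 * Q.card) * Z) := by
        rw [← Finset.mul_sum]
        gcongr
        exact hZs.sum_le_tsum _ fun n _ => by positivity
    _ = _ := by ring

/-! ### The second moment -/

/-- The second moment method for the fibres of a map `g` from `T` into a set `I` of at most `x`
elements: the fibres of size less than half the mean `T.card / x` contain at most half of `T`, and
the Cauchy–Schwarz inequality applies to the rest. -/
theorem card_sq_le_mul_card_large_fibers {α : Type*} (T : Finset α) (I : Finset ℕ) (g : α → ℕ)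
    (hg : ∀ t ∈ T, g t ∈ I) {x : ℝ} (hx : 0 < x) (hI : (I.card : ℝ) ≤ x) :
    (T.card : ℝ) ^ 2 ≤
      4 * (I.filter fun n => (T.card : ℝ) / (2 * x) ≤ (T.filter fun t => g t = n).card).card *
        ∑ t ∈ T, ∑ u ∈ T, if g t = g u then (1 : ℝ) else 0 := by
  set r : ℕ → ℝ := fun n => ((T.filter fun t => g t = n).card : ℝ) with hr
  set G := I.filter fun n => (T.card : ℝ) / (2 * x) ≤ r n with hG
  have hsum : ∑ n ∈ I, r n = T.card := by
    rw [Finset.card_eq_sum_card_fiberwise hg]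
    push_cast
    rfl
  have hsq : ∑ t ∈ T, ∑ u ∈ T, (if g t = g u then (1 : ℝ) else 0) = ∑ n ∈ I, r n ^ 2 := by
    have h1 : ∀ t ∈ T, ∑ u ∈ T, (if g t = g u then (1 : ℝ) else 0) = r (g t) := fun t _ => by
      simp_rw [eq_comm (a := g t)]
      rw [Finset.sum_boole]
    rw [Finset.sum_congr rfl h1, ← Finset.sum_fiberwise_of_maps_to hg]
    refine Finset.sum_congr rfl fun n _ => ?_
    rw [Finset.sum_congr rfl fun t ht => by rw [(Finset.mem_filter.1 ht).2], Finset.sum_const,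
      nsmul_eq_mul, sq]
  have hbad : ∑ n ∈ I.filter (fun n => ¬ (T.card : ℝ) / (2 * x) ≤ r n), r n ≤ T.card / 2 := by
    calc _ ≤ (I.filter (fun n => ¬ (T.card : ℝ) / (2 * x) ≤ r n)).card •
          ((T.card : ℝ) / (2 * x)) :=
          Finset.sum_le_card_nsmul _ _ _ fun n hn => (not_le.1 (Finset.mem_filter.1 hn).2).le
      _ ≤ x * ((T.card : ℝ) / (2 * x)) := by
          rw [nsmul_eq_mul]
          gcongr
          refine le_trans ?_ hI
          exact_mod_cast Finset.card_filter_le _ _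
      _ = T.card / 2 := by field_simp
  have hgood : (T.card : ℝ) / 2 ≤ ∑ n ∈ G, r n := by
    have := Finset.sum_filter_add_sum_filter_not I (fun n => (T.card : ℝ) / (2 * x) ≤ r n) r
    rw [hsum] at this
    linarith
  have hcs : (∑ n ∈ G, r n) ^ 2 ≤ G.card * ∑ n ∈ I, r n ^ 2 := by
    refine sq_sum_le_card_mul_sum_sq.trans ?_
    gcongr
    exact Finset.filter_subset _ _
  have hsq' : ((T.card : ℝ) / 2) ^ 2 ≤ (∑ n ∈ G, r n) ^ 2 := by gcongr
  rw [hsq]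
  linarith

/-! ### Counting coincidences -/

theorem finite_setOf_le {a : ℕ → ℕ} (ha : StrictMono a) (x : ℝ) :
    {k : ℕ | (a k : ℝ) ≤ x}.Finite := by
  refine (Set.finite_Iic ⌊x⌋₊).subset fun k hk => ?_
  exact (ha.le_apply).trans (Nat.le_floor hk)

theorem sum_add_eq_le_countShift {a : ℕ → ℕ} (ha : StrictMono a) {x : ℝ} {K : Finset ℕ}
    (hK : ∀ k ∈ K, (a k : ℝ) ≤ x) (r : ℕ) :
    ∑ k ∈ K, ∑ l ∈ K, (if a k + r = a l then (1 : ℝ) else 0) ≤ countShift a x r := by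
  classical
  have h1 : ∀ k ∈ K, ∑ l ∈ K, (if a k + r = a l then (1 : ℝ) else 0) ≤
      if a k + r ∈ Set.range a then 1 else 0 := by
    intro k _
    rw [Finset.sum_boole]
    split_ifs with h
    · have : (K.filter fun l => a k + r = a l).card ≤ 1 := by
        refine Finset.card_le_one.2 fun l hl m hm => ha.injective ?_
        rw [← (Finset.mem_filter.1 hl).2, ← (Finset.mem_filter.1 hm).2]
      exact_mod_cast this
    · rw [Finset.filter_false_of_mem]
      · simp
      · exact fun l _ hl => h ⟨l, hl.symm⟩
  refine (Finset.sum_le_sum h1).trans ?_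
  rw [Finset.sum_boole, Nat.cast_le, ← Set.ncard_coe_finset]
  refine Set.ncard_le_ncard ?_ ((finite_setOf_le ha x).subset fun k hk => hk.1)
  intro k hk
  have hk := Finset.mem_filter.1 (Finset.mem_coe.1 hk)
  exact ⟨hK k hk.1, hk.2⟩

theorem sum_add_eq_add_le_card {a : ℕ → ℕ} (ha : StrictMono a) (K : Finset ℕ) (s : ℕ) :
    ∑ k ∈ K, ∑ l ∈ K, (if a k + s = a l + s then (1 : ℝ) else 0) = K.card := by
  rw [Finset.card_eq_sum_ones, Nat.cast_sum]
  refine Finset.sum_congr rfl fun k hk => ?_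
  simp only [add_left_inj, ha.injective.eq_iff, Finset.sum_ite_eq, hk, if_true, Nat.cast_one]

theorem sum_add_eq_add_le_countShift {a : ℕ → ℕ} (ha : StrictMono a) {x : ℝ} {K : Finset ℕ}
    (hK : ∀ k ∈ K, (a k : ℝ) ≤ x) (s t : ℕ) :
    ∑ k ∈ K, ∑ l ∈ K, (if a k + s = a l + t then (1 : ℝ) else 0) ≤
      countShift a x ((t : ℤ) - s).natAbs := by
  rcases le_total s t with h | h
  · rw [Finset.sum_comm]
    refine le_of_eq_of_le ?_ (sum_add_eq_le_countShift ha hK _)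
    refine Finset.sum_congr rfl fun l _ => Finset.sum_congr rfl fun k _ => ?_
    congr 1
    exact propext (by omega)
  · refine le_of_eq_of_le ?_ (sum_add_eq_le_countShift ha hK _)
    refine Finset.sum_congr rfl fun l _ => Finset.sum_congr rfl fun k _ => ?_
    congr 1
    exact propext (by omega)

theorem finite_setOf_eval_eq (f : ℤ[X]) (hd : 1 ≤ f.natDegree) (c : ℤ) :
    {q : ℕ | f.eval (q : ℤ) = c}.Finite := by
  have h0 : 0 < f.degree := natDegree_pos_iff_degree_pos.1 hd
  refine Set.Finite.of_finite_image (f := ((↑) : ℕ → ℤ)) ?_ Nat.cast_injective.injOn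
  refine (f - C c).roots.toFinset.finite_toSet.subset ?_
  rintro _ ⟨q, hq, rfl⟩
  rw [Finset.mem_coe, Multiset.mem_toFinset, mem_roots_sub_C h0]
  exact hq

theorem card_filter_eval_eq_le (f : ℤ[X]) (hd : 1 ≤ f.natDegree) (c : ℤ) (Q : Finset ℕ) :
    (Q.filter fun q : ℕ => f.eval (q : ℤ) = c).card ≤ f.natDegree := by
  have h0 : 0 < f.degree := natDegree_pos_iff_degree_pos.1 hd
  rw [← Finset.card_image_of_injective _ (Nat.cast_injective (R := ℤ))]
  refine (Finset.card_le_card (t := (f - C c).roots.toFinset) ?_).trans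
    ((Multiset.toFinset_card_le _).trans (card_roots_sub_C' h0))
  intro z hz
  obtain ⟨q, hq, rfl⟩ := Finset.mem_image.1 hz
  rw [Multiset.mem_toFinset, mem_roots_sub_C h0]
  exact (Finset.mem_filter.1 hq).2

theorem finite_rep {a : ℕ → ℕ} (ha : StrictMono a) (f : ℤ[X]) (hd : 1 ≤ f.natDegree)
    (hf : ∀ m : ℕ, 0 < m → 0 < f.eval (m : ℤ)) (n : ℕ) :
    {kp : ℕ × ℕ | kp.2.Prime ∧ (a kp.1 : ℤ) + f.eval (kp.2 : ℤ) = (n : ℤ)}.Finite := by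
  refine ((Set.finite_Iic n).biUnion fun k _ =>
    (Set.finite_singleton k).prod (finite_setOf_eval_eq f hd (n - a k))).subset ?_
  rintro ⟨k, p⟩ ⟨hp, h⟩
  simp only [Set.mem_iUnion, Set.mem_Iic, Set.mem_prod, Set.mem_singleton_iff, Set.mem_ofPred_eq]
  simp only at hp h
  refine ⟨k, ?_, rfl, by linarith⟩
  have h1 := hf p hp.pos
  have h2 : k ≤ a k := ha.le_apply
  omega

/-- The number of coincidences `a_k + f(p) = a_l + f(q)` is at most the contribution of
`f(p) = f(q)`, which forces `k = l`, plus that of the shifts `r = |f(q) - f(p)| ≠ 0`. -/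
theorem sum_pairs_le {a : ℕ → ℕ} (ha : StrictMono a) {x : ℝ} {K Q : Finset ℕ}
    (hK : ∀ k ∈ K, (a k : ℝ) ≤ x) (f : ℤ[X]) (hd : 1 ≤ f.natDegree)
    (hQ : ∀ q ∈ Q, 0 ≤ f.eval (q : ℤ)) {A B : ℝ} (hA : 0 ≤ A)
    (hshift : ∀ r : ℕ, 0 < r → (countShift a x r : ℝ) ≤ A * ((r : ℝ) / Nat.totient r))
    (hB : ∀ p ∈ Q, ∑ q ∈ Q.filter (fun q : ℕ => f.eval (q : ℤ) ≠ f.eval (p : ℤ)),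
        (((f.eval (q : ℤ) - f.eval (p : ℤ)).natAbs : ℝ) /
          Nat.totient (f.eval (q : ℤ) - f.eval (p : ℤ)).natAbs) ≤ B) :
    ∑ t ∈ K ×ˢ Q, ∑ u ∈ K ×ˢ Q,
        (if a t.1 + (f.eval (t.2 : ℤ)).toNat = a u.1 + (f.eval (u.2 : ℤ)).toNat
          then (1 : ℝ) else 0) ≤ Q.card * (f.natDegree * K.card + A * B) := by
  set N : ℕ → ℕ → ℝ := fun p q => ∑ k ∈ K, ∑ l ∈ K,
    (if a k + (f.eval (p : ℤ)).toNat = a l + (f.eval (q : ℤ)).toNat then (1 : ℝ) else 0) with hN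
  have hrw : ∑ t ∈ K ×ˢ Q, ∑ u ∈ K ×ˢ Q,
        (if a t.1 + (f.eval (t.2 : ℤ)).toNat = a u.1 + (f.eval (u.2 : ℤ)).toNat
          then (1 : ℝ) else 0) = ∑ p ∈ Q, ∑ q ∈ Q, N p q := by
    rw [Finset.sum_product_right]
    refine Finset.sum_congr rfl fun p _ => ?_
    simp_rw [Finset.sum_product_right]
    rw [Finset.sum_comm]
  rw [hrw, ← nsmul_eq_mul]
  refine Finset.sum_le_card_nsmul _ _ _ fun p hp => ?_
  rw [← Finset.sum_filter_add_sum_filter_not Q (fun q : ℕ => f.eval (q : ℤ) = f.eval (p : ℤ))]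
  refine add_le_add ?_ ?_
  · calc _ ≤ (Q.filter fun q : ℕ => f.eval (q : ℤ) = f.eval (p : ℤ)).card • (K.card : ℝ) := by
          refine Finset.sum_le_card_nsmul _ _ _ fun q hq => ?_
          simp only [hN]
          rw [(Finset.mem_filter.1 hq).2, sum_add_eq_add_le_card ha]
      _ ≤ f.natDegree * K.card := by
          rw [nsmul_eq_mul]
          gcongr
          exact card_filter_eval_eq_le f hd _ Q
  · calc _ ≤ ∑ q ∈ Q.filter (fun q : ℕ => f.eval (q : ℤ) ≠ f.eval (p : ℤ)),
        A * (((f.eval (q : ℤ) - f.eval (p : ℤ)).natAbs : ℝ) /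
          Nat.totient (f.eval (q : ℤ) - f.eval (p : ℤ)).natAbs) := by
          refine Finset.sum_le_sum fun q hq => ?_
          obtain ⟨hq, hne⟩ := Finset.mem_filter.1 hq
          have h := sum_add_eq_add_le_countShift ha hK (f.eval (p : ℤ)).toNat
            (f.eval (q : ℤ)).toNat
          rw [Int.toNat_of_nonneg (hQ p hp), Int.toNat_of_nonneg (hQ q hq)] at h
          exact h.trans (hshift _ (Int.natAbs_pos.2 (sub_ne_zero.2 hne)))
      _ ≤ A * B := by
          rw [← Finset.mul_sum]
          exact mul_le_mul_of_nonneg_left (hB p hp) hA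

/-! ### Choice of parameters -/

/-- With `s ≥ c t` the mean number of representations, this converts the second moment inequality
for the number `G` of well-represented integers into the required lower bound. -/
theorem const_mul_div_le {c d D x s t G : ℝ} (hc : 0 < c) (hd : 0 < d) (hD : 0 < D) (hx : 0 < x)
    (ht : 0 < t) (hst : c * t ≤ s) (h : x * s ≤ 4 * G * (d + D * s)) :
    c / (4 * (d + D * c)) * x * (t / (1 + t)) ≤ G := by
  have hs : 0 < s := lt_of_lt_of_le (by positivity) hst
  have h1 : s / (d + D * s) ≤ 4 * G / x := by
    rw [div_le_div_iff₀ (by positivity) hx]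
    linarith
  have h2 : c * t / (d + D * (c * t)) ≤ s / (d + D * s) := by
    rw [div_le_div_iff₀ (by positivity) (by positivity)]
    linarith [mul_le_mul_of_nonneg_left hst hd.le]
  have h3 : c * t / ((d + D * c) * (1 + t)) ≤ c * t / (d + D * (c * t)) := by
    refine div_le_div_of_nonneg_left (by positivity) (by positivity) ?_
    have : 0 ≤ d * t + D * c := by positivity
    linarith
  calc c / (4 * (d + D * c)) * x * (t / (1 + t))
      = x / 4 * (c * t / ((d + D * c) * (1 + t))) := by field_simp
    _ ≤ x / 4 * (4 * G / x) := mul_le_mul_of_nonneg_left (h3.trans (h2.trans h1)) (by positivity)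
    _ = G := by field_simp

/-- With `Y = ⌊(x / 2F)^(1/d)⌋`, so that `F * Y ^ d ≤ x / 2`, there are `≫ x^(1/d) / log x`
large primes up to `Y`. -/
theorem exists_scale (F d : ℕ) (hF : 0 < F) (hd : 1 ≤ d) (Y₁ : ℕ) :
    ∃ b : ℝ, 0 < b ∧ ∃ x₁ : ℝ, 2 ≤ x₁ ∧ ∀ x : ℝ, x₁ ≤ x → ∃ Y : ℕ, Y₁ ≤ Y ∧ 1 ≤ Y ∧
      (F : ℝ) * (Y : ℝ) ^ d ≤ x / 2 ∧
      b * (x ^ ((1 : ℝ) / (d : ℝ)) / Real.log x) ≤ (largePrimes Y).card := by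
  obtain ⟨Y₂, hY₂⟩ := eventually_le_card_largePrimes_mul_log
  have hF0 : (0 : ℝ) < F := by exact_mod_cast hF
  have hF1 : (1 : ℝ) ≤ F := by exact_mod_cast hF
  have hd0 : (0 : ℝ) < d := by exact_mod_cast hd
  set β : ℝ := (1 / (2 * F : ℝ)) ^ ((1 : ℝ) / (d : ℝ)) with hβ
  have hβ0 : 0 < β := by positivity
  have hl2 : 0 < Real.log 2 := Real.log_pos (by norm_num)
  set Z : ℕ := Y₁ + Y₂ + 2 with hZ
  refine ⟨Real.log 2 / 8 * β, by positivity, max 2 (2 * F * (Z : ℝ) ^ d), le_max_left _ _,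
    fun x hx => ?_⟩
  have hx2 : 2 ≤ x := (le_max_left _ _).trans hx
  have hxZ : 2 * F * (Z : ℝ) ^ d ≤ x := (le_max_right _ _).trans hx
  set z : ℝ := (x / (2 * F)) ^ ((1 : ℝ) / (d : ℝ)) with hz
  have hz0 : 0 ≤ z := by positivity
  have hzd : z ^ d = x / (2 * F) := by
    rw [hz, one_div, Real.rpow_inv_natCast_pow (by positivity) (by omega)]
  have hZz : (Z : ℝ) ≤ z := by
    rw [← pow_le_pow_iff_left₀ (by positivity) hz0 (by omega : d ≠ 0), hzd,
      le_div_iff₀ (by positivity)]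
    linarith
  have hZY : Z ≤ ⌊z⌋₊ := Nat.le_floor hZz
  set Y := ⌊z⌋₊ with hY
  have hYz : (Y : ℝ) ≤ z := Nat.floor_le hz0
  have hzY : z ≤ 2 * Y := by
    have h1 := Nat.lt_floor_add_one z
    have h2 : (1 : ℝ) ≤ Y := by exact_mod_cast (by omega : 1 ≤ Y)
    linarith
  have hY2 : (2 : ℝ) ≤ Y := by exact_mod_cast (by omega : 2 ≤ Y)
  have hYd : (Y : ℝ) ^ d ≤ x / (2 * F) := hzd ▸ pow_le_pow_left₀ (by positivity) hYz d
  have hYx : (Y : ℝ) ≤ x := by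
    calc (Y : ℝ) ≤ (Y : ℝ) ^ d := le_self_pow₀ (by linarith) (by omega)
      _ ≤ x / (2 * F) := hYd
      _ ≤ x := div_le_self (by linarith) (by linarith)
  have hlogY : 0 < Real.log Y := Real.log_pos (by linarith)
  have hlogYx : Real.log Y ≤ Real.log x := Real.log_le_log (by linarith) hYx
  refine ⟨Y, by omega, by omega, ?_, ?_⟩
  · calc (F : ℝ) * (Y : ℝ) ^ d ≤ F * (x / (2 * F)) := by gcongr
      _ = x / 2 := by field_simp
  · have hzβ : z = β * x ^ ((1 : ℝ) / (d : ℝ)) := by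
      rw [hz, hβ, ← Real.mul_rpow (by positivity) (by linarith)]
      congr 1
      ring
    have hQ := hY₂ Y (by omega)
    calc Real.log 2 / 8 * β * (x ^ ((1 : ℝ) / (d : ℝ)) / Real.log x)
        = Real.log 2 / 8 * z / Real.log x := by rw [hzβ]; ring
      _ ≤ Real.log 2 / 8 * z / Real.log Y := by gcongr
      _ ≤ (largePrimes Y).card := by
          rw [div_le_iff₀ hlogY]
          nlinarith

end RomanoffSum

theorem theoremT (f : Polynomial ℤ) (d : ℕ) (hd : 1 ≤ d) (hfd : f.natDegree = d)
    (hlead : 0 < f.leadingCoeff) (hf : ∀ m : ℕ, 0 < m → 0 < f.eval (m : ℤ))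
    (K₁ K₂ K₃ K₄ : ℝ) (hK₁ : 0 < K₁) (hK₂ : 0 < K₂) (hK₃ : 0 < K₃) (hK₄ : 0 < K₄) :
    ∃ c₁ c₂ : ℝ, 0 < c₁ ∧ 0 < c₂ ∧ ∀ X : ℝ, ∃ x₀ : ℝ, 0 < x₀ ∧
      ∀ (a : ℕ → ℕ) (η : ℝ → ℝ), RomanoffSum.Admissible K₁ K₂ K₃ K₄ X a η →
        ∀ x : ℝ, x₀ ≤ x →
          c₂ * x * (x ^ ((1 : ℝ) / (d : ℝ)) /
              (x ^ ((1 : ℝ) / (d : ℝ)) + η x * Real.log x)) ≤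
            (Set.ncard {n : ℕ | 1 ≤ n ∧ (n : ℝ) ≤ x ∧
              c₁ * (x ^ ((1 : ℝ) / (d : ℝ)) / (η x * Real.log x)) ≤
                (RomanoffSum.rep a f n : ℝ)} : ℝ) := by
  have hd' : 1 ≤ f.natDegree := by omega
  obtain ⟨F, hF, hFle⟩ := RomanoffSum.exists_abs_eval_le f
  obtain ⟨C, hC, Y₀, hY₀⟩ := RomanoffSum.exists_sum_div_totient_le f hd'
  obtain ⟨b, hb, x₁, hx₁2, hx₁⟩ := RomanoffSum.exists_scale F d hF hd Y₀
  set c : ℝ := b / (K₂ * K₃) with hc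
  set D : ℝ := K₄ * C * (K₂ * K₃) ^ 2 with hD
  have hd0 : (0 : ℝ) < d := by exact_mod_cast hd
  have hc0 : 0 < c := by positivity
  have hD0 : 0 < D := by positivity
  refine ⟨c / 2, c / (4 * (d + D * c)), by positivity, by positivity, fun X =>
    ⟨max x₁ X, by have := le_max_left x₁ X; linarith, fun a η hadm x hx => ?_⟩⟩
  have hx1 : x₁ ≤ x := (le_max_left _ _).trans hx
  have hxX : X ≤ x := (le_max_right _ _).trans hx
  have hx2 : 2 ≤ x := hx₁2.trans hx1
  have hx0 : 0 < x := by linarith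
  have hη : 0 < η x := hadm.eta_pos x hxX
  have hlog : 0 < Real.log x := Real.log_pos (by linarith)
  obtain ⟨Y, hYY, hY1, hYd, hQb⟩ := hx₁ x hx1
  set L : ℝ := x ^ ((1 : ℝ) / (d : ℝ)) with hL
  have hL0 : 0 < L := by positivity
  set Q := RomanoffSum.largePrimes Y with hQ
  have hfin := RomanoffSum.finite_setOf_le hadm.strictMono (x / 2)
  set K := hfin.toFinset with hK
  have hKmem : ∀ k, k ∈ K ↔ (a k : ℝ) ≤ x / 2 := fun k => by rw [hK, Set.Finite.mem_toFinset]; rfl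
  have hKcard : (K.card : ℝ) = RomanoffSum.count a (x / 2) := by
    rw [RomanoffSum.count, Set.ncard_eq_toFinset_card _ hfin]
  -- lower bounds for the sizes of the two sets of summands
  have hKx : x / η x ≤ K₂ * K₃ * K.card := by
    rw [hKcard, mul_assoc]
    exact (hadm.le_count x hxX).trans (by gcongr; exact hadm.count_half x hxX)
  have hKpos : (0 : ℝ) < K.card := by
    have : 0 < x / η x := by positivity
    have h2 : 0 < K₂ * K₃ := by positivity
    exact pos_of_mul_pos_right (this.trans_le hKx) h2.le
  have hQpos : (0 : ℝ) < Q.card := lt_of_lt_of_le (by positivity) hQb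
  set T := K ×ˢ Q with hT
  have hTcard : (T.card : ℝ) = K.card * Q.card := by
    rw [hT, Finset.card_product, Nat.cast_mul]
  set s : ℝ := T.card / x with hs
  set t : ℝ := L / (η x * Real.log x) with ht
  have ht0 : 0 < t := by positivity
  have hst : c * t ≤ s := by
    rw [hs, le_div_iff₀ hx0, hTcard]
    calc c * t * x = (x / η x) / (K₂ * K₃) * (b * (L / Real.log x)) := by
          rw [hc, ht]; field_simp
      _ ≤ K.card * Q.card := by
          have : x / η x / (K₂ * K₃) ≤ K.card := by
            rw [div_le_iff₀ (by positivity)]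
            linarith
          gcongr
  -- the second moment
  set g : ℕ × ℕ → ℕ := fun u => a u.1 + (f.eval (u.2 : ℤ)).toNat with hg
  have hQnn : ∀ q ∈ Q, 0 ≤ f.eval (q : ℤ) := fun q hq =>
    (hf q (RomanoffSum.mem_largePrimes.1 hq).2.1.pos).le
  have hpairs := RomanoffSum.sum_pairs_le hadm.strictMono (x := x) (K := K) (Q := Q)
    (A := K₄ * (x / η x ^ 2)) (B := C * Q.card)
    (fun k hk => ((hKmem k).1 hk).trans (by linarith)) f hd' hQnn (by positivity)
    (fun r hr => (hadm.countShift_le x hxX r hr).trans (le_of_eq (by ring)))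
    (fun p hp => hY₀ Y hYY p (RomanoffSum.mem_largePrimes.1 hp).1)
  rw [hfd] at hpairs
  have hpairs' : Q.card * (d * (K.card : ℝ) + K₄ * (x / η x ^ 2) * (C * Q.card)) ≤
      T.card * (d + D * s) := by
    have h1 : x / η x ^ 2 ≤ (K₂ * K₃ * K.card) ^ 2 / x := by
      calc x / η x ^ 2 = (x / η x) ^ 2 / x := by field_simp
        _ ≤ (K₂ * K₃ * K.card) ^ 2 / x := by gcongr
    calc _ ≤ Q.card * (d * (K.card : ℝ) +
          K₄ * ((K₂ * K₃ * K.card) ^ 2 / x) * (C * Q.card)) := by gcongr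
      _ = _ := by rw [hD, hs, hTcard]; ring
  have hgmem : ∀ u ∈ T, g u ∈ Finset.Icc 1 ⌊x⌋₊ := by
    rintro ⟨k, p⟩ hu
    obtain ⟨hk, hp⟩ := Finset.mem_product.1 hu
    have hk' := (hKmem k).1 hk
    have hp' := RomanoffSum.mem_largePrimes.1 hp
    have hpos := hadm.pos k
    refine Finset.mem_Icc.2 ⟨by simp only [hg]; omega, Nat.le_floor ?_⟩
    have h1 : (f.eval (p : ℤ)).toNat ≤ F * Y ^ d := by
      have := hFle p Y hY1 hp'.1
      rw [hfd] at this
      omega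
    have h2 : (((f.eval (p : ℤ)).toNat : ℕ) : ℝ) ≤ F * (Y : ℝ) ^ d := by exact_mod_cast h1
    simp only [hg]
    push_cast
    linarith
  have hI : ((Finset.Icc 1 ⌊x⌋₊).card : ℝ) ≤ x := by
    rw [Nat.card_Icc, Nat.add_sub_cancel]
    exact Nat.floor_le hx0.le
  have hsm := RomanoffSum.card_sq_le_mul_card_large_fibers T (Finset.Icc 1 ⌊x⌋₊) g hgmem hx0 hI
  set G := (Finset.Icc 1 ⌊x⌋₊).filter fun n =>
    (T.card : ℝ) / (2 * x) ≤ (T.filter fun u => g u = n).card with hG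
  -- the integers with a large fibre have many representations
  have hGsub : (G : Set ℕ) ⊆ {n : ℕ | 1 ≤ n ∧ (n : ℝ) ≤ x ∧
      c / 2 * t ≤ (RomanoffSum.rep a f n : ℝ)} := by
    intro n hn
    obtain ⟨hnI, hn⟩ := Finset.mem_filter.1 (Finset.mem_coe.1 hn)
    obtain ⟨hn1, hnx⟩ := Finset.mem_Icc.1 hnI
    refine ⟨hn1, (Nat.le_floor_iff hx0.le).1 hnx, ?_⟩
    have h1 : (T.card : ℝ) / (2 * x) = s / 2 := by rw [hs]; field_simp
    have h2 : (T.filter fun u => g u = n).card ≤ RomanoffSum.rep a f n := by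
      rw [RomanoffSum.rep, ← Set.ncard_coe_finset]
      refine Set.ncard_le_ncard ?_ (RomanoffSum.finite_rep hadm.strictMono f hd' hf n)
      rintro ⟨k, p⟩ hu
      obtain ⟨hu, hgu⟩ := Finset.mem_filter.1 (Finset.mem_coe.1 hu)
      have hp := (Finset.mem_product.1 hu).2
      refine ⟨(RomanoffSum.mem_largePrimes.1 hp).2.1, ?_⟩
      have h3 := hQnn p hp
      simp only [hg] at hgu h3 ⊢
      omega
    have h2' : (((T.filter fun u => g u = n).card : ℕ) : ℝ) ≤ RomanoffSum.rep a f n :=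
      Nat.cast_le.2 h2
    linarith
  have hGcard : (G.card : ℝ) ≤ (Set.ncard {n : ℕ | 1 ≤ n ∧ (n : ℝ) ≤ x ∧
      c / 2 * t ≤ (RomanoffSum.rep a f n : ℝ)} : ℝ) := by
    rw [← Set.ncard_coe_finset G, Nat.cast_le]
    refine Set.ncard_le_ncard hGsub ((Set.finite_Iic ⌊x⌋₊).subset fun n hn => ?_)
    exact Nat.le_floor hn.2.1
  refine le_trans ?_ hGcard
  have hTpos : (0 : ℝ) < T.card := by rw [hTcard]; positivity
  have hs0 : 0 < s := by positivity
  -- cancel a factor `T.card` in the second moment inequality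
  have hmain : x * s ≤ 4 * G.card * (d + D * s) := by
    have hxs : x * s = T.card := by rw [hs]; field_simp
    rw [hxs]
    refine le_of_mul_le_mul_left ?_ hTpos
    calc (T.card : ℝ) * T.card = (T.card : ℝ) ^ 2 := by ring
      _ ≤ 4 * G.card * (T.card * (d + D * s)) := by
          refine hsm.trans ?_
          gcongr
          exact hpairs.trans hpairs'
      _ = T.card * (4 * G.card * (d + D * s)) := by ring
  have hratio : L / (L + η x * Real.log x) = t / (1 + t) := by
    rw [ht]; field_simp; ring
  rw [hratio]
  exact RomanoffSum.const_mul_div_le hc0 hd0 hD0 hx0 ht0 hst hmain
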